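/- Let $\mathcal S_4$ be the set of real symmetric $4\times 4$ matrices. For $X=(x_{ij})\in\mathcal S_4$ let $S(X)=\sqrt{\sum_{i<j}x_{ij}^2}$ be its off-norm. For a pair $(i,j)$ with $i<j$ let $R(i,j,\varphi)$ be the plane rotation which agrees with the identity matrix except for the entries $\cos\varphi$, $-\sin\varphi$, $\sin\varphi$, $\cos\varphi$ at the positions $(i,i)$, $(i,j)$, $(j,i)$, $(j,j)$, respectively. Given an ordering $(i_0,j_0),\dots,(i_5,j_5)$ of the six pairs $(i,j)$, $1\le i<j\le 4$, the cyclic Jacobi method under that ordering generates from $A^{(0)}=A\in\mathcal S_4$ the matrices $$A^{(k+1)}=R_k^{T}A^{(k)}R_k,\qquad R_k=R(i,j,\varphi^{(k)}),\quad (i,j)=(i_{k \bmod 6},j_{k \bmod 6}),\quad k\ge 0,$$ where $\varphi^{(k)}\in[-\pi/4,\pi/4]$ satisfies $\tan 2\varphi^{(k)}=2a^{(k)}_{ij}/(a^{(k)}_{ii}-a^{(k)}_{jj})$, with $\varphi^{(k)}=0$ if $a^{(k)}_{ij}=0$ and $a^{(k)}_{ii}=a^{(k)}_{jj}$, and with $\varphi^{(k)}$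 either of $\pm\pi/4$ if $a^{(k)}_{ij}\ne 0$ and $a^{(k)}_{ii}=a^{(k)}_{jj}$. **Theorem.** (i) Let $A\in\mathcal S_4$ satisfy $a_{12}=a_{34}=0$, and let $A^{(12)}$ be obtained from $A$ by $12$ steps (two sweeps) of the cyclic Jacobi method under the ordering $\mathcal O_1=(1,3),(2,4),(1,4),(2,3),(1,2),(3,4)$. Then $$S(A^{(12)})\le(1-10^{-5})\,S(A).$$ (ii) The Jacobi method is globally convergent under all six fully parallel strategies: for each of the orderings $$\begin{aligned} &(1,3),(2,4),(1,4),(2,3),(1,2),(3,4), &\quad &(1,4),(2,3),(1,3),(2,4),(1,2),(3,4),\\ &(1,2),(3,4),(1,3),(2,4),(1,4),(2,3), &\quad &(1,2),(3,4),(1,4),(2,3),(1,3),(2,4),\\ &(1,4),(2,3),(1,2),(3,4),(1,3),(2,4), &\quad &(1,3),(2,4),(1,2),(3,4),(1,4),(2,3), \end{aligned}$$ and for every $A\in\mathcal S_4$ (without any condition on its entries), every sequence $(A^{(k)})_{k\ge0}$ generated by the cyclic Jacobi method from $A$ converges to a diagonal matrix. -/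

import Mathlib

open Filter Topology

/-- The pivot pairs `(i, j)`, `i < j`, of a matrix of order `n` (indices are counted from `0`). -/
abbrev PivotPair (n : ℕ) : Type := {p : Fin n × Fin n // p.1 < p.2}

/-- The plane rotation `R(i, j, φ)`: the identity matrix, except for the entries at `(i, i)`,
`(i, j)`, `(j, i)`, `(j, j)`, which are `cos φ`, `-sin φ`, `sin φ`, `cos φ`. -/
noncomputable def planeRotation {n : ℕ} (p : PivotPair n) (φ : ℝ) :
    Matrix (Fin n) (Fin n) ℝ :=
  Matrix.of fun r s =>
    if r = p.1.1 ∧ s = p.1.1 then Real.cos φ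
    else if r = p.1.1 ∧ s = p.1.2 then -Real.sin φ
    else if r = p.1.2 ∧ s = p.1.1 then Real.sin φ
    else if r = p.1.2 ∧ s = p.1.2 then Real.cos φ
    else if r = s then 1 else 0

/-- The off-norm `S(X)` of a symmetric matrix: the Euclidean (Frobenius) norm of its strictly
upper-triangular part. -/
noncomputable def offNorm {n : ℕ} (X : Matrix (Fin n) (Fin n) ℝ) : ℝ :=
  Real.sqrt (∑ i, ∑ j ∈ Finset.Ioi i, X i j ^ 2)

/-- `φ` is a Jacobi rotation angle for `A` and the pivot pair `(i, j)`: it lies in `[-π/4, π/4]`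
and satisfies `tan (2φ) = 2 a_ij / (a_ii - a_jj)`, with `φ = 0` if `a_ij = 0` and `a_ii = a_jj`.
The tangent equation is written without denominators, so that for `a_ii = a_jj`, `a_ij ≠ 0` (an
infinite tangent) it says `cos (2φ) = 0`, that is `φ = π/4` or `φ = -π/4`, both being admitted. -/
def IsJacobiAngle {n : ℕ} (A : Matrix (Fin n) (Fin n) ℝ) (p : PivotPair n) (φ : ℝ) : Prop :=
  φ ∈ Set.Icc (-(Real.pi / 4)) (Real.pi / 4) ∧
  Real.sin (2 * φ) * (A p.1.1 p.1.1 - A p.1.2 p.1.2) = 2 * A p.1.1 p.1.2 * Real.cos (2 * φ) ∧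
  (A p.1.1 p.1.2 = 0 → A p.1.1 p.1.1 = A p.1.2 p.1.2 → φ = 0)

/-- `A 0, A 1, A 2, …` is generated from `A 0` by the Jacobi method under the pivot strategy `I`:
`A (k + 1) = R_kᵀ * A k * R_k`, where `R_k` is a Jacobi rotation for `A k` and the pair `I k`. -/
def IsJacobiSequence {n : ℕ} (I : ℕ → PivotPair n) (A : ℕ → Matrix (Fin n) (Fin n) ℝ) : Prop :=
  ∀ k, ∃ φ, IsJacobiAngle (A k) (I k) φ ∧
    A (k + 1) = (planeRotation (I k) φ).transpose * A k * planeRotation (I k) φ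

/-- The Jacobi method under `I` is globally convergent: for each symmetric starting matrix, every
sequence generated by the method converges to a diagonal matrix. -/
def GloballyConvergent {n : ℕ} (I : ℕ → PivotPair n) : Prop :=
  ∀ A : ℕ → Matrix (Fin n) (Fin n) ℝ, (A 0).IsSymm → IsJacobiSequence I A →
    ∃ D : Matrix (Fin n) (Fin n) ℝ, D.IsDiag ∧ Tendsto A atTop (𝓝 D)

/-- The strategy generated by an ordering of length `N`: it runs through the ordering
cyclically. -/
def cyclicStrategy {n N : ℕ} [NeZero N] (O : Fin N → PivotPair n) (k : ℕ) : PivotPair n :=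
  O (Fin.ofNat N k)

/-- The pivot pair with the one-based indices `(1, 2)`. -/
def p12 : PivotPair 4 := ⟨(0, 1), by decide⟩
/-- The pivot pair with the one-based indices `(1, 3)`. -/
def p13 : PivotPair 4 := ⟨(0, 2), by decide⟩
/-- The pivot pair with the one-based indices `(1, 4)`. -/
def p14 : PivotPair 4 := ⟨(0, 3), by decide⟩
/-- The pivot pair with the one-based indices `(2, 3)`. -/
def p23 : PivotPair 4 := ⟨(1, 2), by decide⟩
/-- The pivot pair with the one-based indices `(2, 4)`. -/
def p24 : PivotPair 4 := ⟨(1, 3), by decide⟩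
/-- The pivot pair with the one-based indices `(3, 4)`. -/
def p34 : PivotPair 4 := ⟨(2, 3), by decide⟩

/-- The ordering `O₁`, which generates the strategy `I₁`. -/
def ordering1 : Fin 6 → PivotPair 4 := ![p13, p24, p14, p23, p12, p34]

/-- The orderings of the six fully parallel strategies: `O₁, O₁', O₁'', O₂, O₂', O₂''`. -/
def parallelOrderings : List (Fin 6 → PivotPair 4) :=
  [ordering1,
   ![p12, p34, p13, p24, p14, p23],
   ![p14, p23, p12, p34, p13, p24],
   ![p14, p23, p13, p24, p12, p34],
   ![p12, p34, p14, p23, p13, p24],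
   ![p13, p24, p12, p34, p14, p23]]

/-! ### Real-variable part: the dynamics of two commuting rotations -/

lemma abs_weighted_add_of_mul_nonneg {a b p q : ℝ} (hab : 0 ≤ a * b) (hp : 0 ≤ p) (hq : 0 ≤ q) :
    |a * p + b * q| = |a| * p + |b| * q := by
  have h : 0 ≤ (a * p) * (b * q) := by
    have := mul_nonneg hab (mul_nonneg hp hq)
    nlinarith
  rw [abs_add_eq_add_abs_iff (a * p) (b * q) |>.2, abs_mul, abs_mul, abs_of_nonneg hp,
    abs_of_nonneg hq]
  exact mul_nonneg_iff.1 h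

lemma abs_weighted_sub_of_mul_nonpos {a b p q : ℝ} (hab : a * b ≤ 0) (hp : 0 ≤ p) (hq : 0 ≤ q) :
    |a * p - b * q| = |a| * p + |b| * q := by
  have := abs_weighted_add_of_mul_nonneg (a := a) (b := -b) (by linarith [mul_neg a b]) hp hq
  rwa [abs_neg, neg_mul, ← sub_eq_add_neg] at this

lemma abs_weighted_add_le {a b p q : ℝ} (hp : 0 ≤ p) (hq : 0 ≤ q) :
    |a * p + b * q| ≤ |a| * p + |b| * q := by
  refine (abs_add_le _ _).trans_eq ?_
  rw [abs_mul, abs_mul, abs_of_nonneg hp, abs_of_nonneg hq]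

lemma abs_weighted_sub_le {a b p q : ℝ} (hp : 0 ≤ p) (hq : 0 ≤ q) :
    |a * p - b * q| ≤ |a| * p + |b| * q := by
  refine (abs_sub _ _).trans_eq ?_
  rw [abs_mul, abs_mul, abs_of_nonneg hp, abs_of_nonneg hq]

/-- The cosine `κ` and the absolute sine `s` of a doubled angle close to `±π/2`. -/
structure NearRightAngle (κ s : ℝ) : Prop where
  cos_nonneg : 0 ≤ κ
  cos_le : κ ≤ 1 / 20
  sin_nonneg : 0 ≤ s
  sq_add_sq : s ^ 2 + κ ^ 2 = 1

namespace NearRightAngle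

variable {κ s : ℝ}

lemma one_sub_le (h : NearRightAngle κ s) : 1 - s ≤ κ / 20 := by
  obtain ⟨h1, h2, h3, h4⟩ := h
  have : s ≤ 1 := by nlinarith
  nlinarith

lemma half_le (h : NearRightAngle κ s) : 1 / 2 ≤ s := by
  have := h.one_sub_le
  linarith [h.cos_le]

lemma sin_le_one (h : NearRightAngle κ s) : s ≤ 1 := by
  nlinarith [h.sq_add_sq, sq_nonneg κ]

end NearRightAngle

lemma gap_eq_zero_of_same_signs {a b a₁ b₁ κ₁ μ₁ s₁ σ₁ : ℝ}
    (h₁ : NearRightAngle κ₁ s₁) (h₁' : NearRightAngle μ₁ σ₁)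
    (hsum : a₁ * κ₁ - b₁ * μ₁ = a + b)
    (hdef : |a₁ * s₁ + b₁ * σ₁| ≤ (|a| + |b|) / 40)
    (hab : 0 ≤ a * b) (hab₁ : 0 ≤ a₁ * b₁) : |a| + |b| = 0 := by
  have e1 : |a + b| = |a| + |b| := by
    simpa using abs_weighted_add_of_mul_nonneg hab zero_le_one zero_le_one
  rw [abs_weighted_add_of_mul_nonneg hab₁ h₁.sin_nonneg h₁'.sin_nonneg] at hdef
  have e2 := abs_weighted_sub_le (a := a₁) (b := b₁) h₁.cos_nonneg h₁'.cos_nonneg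
  rw [hsum, e1] at e2
  have := h₁.half_le
  have := h₁'.half_le
  nlinarith [abs_nonneg a, abs_nonneg b, abs_nonneg a₁, abs_nonneg b₁, h₁.cos_le, h₁'.cos_le]

lemma gap_eq_zero_of_opposite_signs {a b a₁ b₁ κ₁ μ₁ s₁ σ₁ a₂ b₂ κ₂ μ₂ s₂ σ₂ : ℝ}
    (h₁ : NearRightAngle κ₁ s₁) (h₁' : NearRightAngle μ₁ σ₁)
    (h₂ : NearRightAngle κ₂ s₂) (h₂' : NearRightAngle μ₂ σ₂)
    (hsum : a₁ * κ₁ - b₁ * μ₁ = a + b) (hsum₁ : a₂ * κ₂ - b₂ * μ₂ = a₁ + b₁)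
    (hdiff : a₂ * κ₂ + b₂ * μ₂ = a - b)
    (hdef₁ : |a₁ * s₁ + b₁ * σ₁| ≤ (|a| + |b|) / 40)
    (hdef₂ : |a₂ * s₂ + b₂ * σ₂| ≤ (|a| + |b|) / 40)
    (hab : a * b ≤ 0) : |a| + |b| = 0 := by
  have e1 : |a - b| = |a| + |b| := by
    simpa using abs_weighted_sub_of_mul_nonpos hab zero_le_one zero_le_one
  have hR : 0 ≤ |a| + |b| := by positivity
  have p1 := h₁.half_le
  have p1' := h₁'.half_le
  have p2 := h₂.half_le
  have p2' := h₂'.half_le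
  rcases le_total 0 (a₂ * b₂) with hab₂ | hab₂
  · rw [abs_weighted_add_of_mul_nonneg hab₂ h₂.sin_nonneg h₂'.sin_nonneg] at hdef₂
    have e2 := abs_weighted_add_le (a := a₂) (b := b₂) h₂.cos_nonneg h₂'.cos_nonneg
    rw [hdiff, e1] at e2
    nlinarith [abs_nonneg a₂, abs_nonneg b₂, h₂.cos_le, h₂'.cos_le]
  · have e2 : |a| + |b| ≤ |a₁ + b₁| := by
      rw [← e1, ← hdiff, ← hsum₁,
        abs_weighted_sub_of_mul_nonpos hab₂ h₂.cos_nonneg h₂'.cos_nonneg]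
      exact abs_weighted_add_le h₂.cos_nonneg h₂'.cos_nonneg
    rcases le_total 0 (a₁ * b₁) with hab₁ | hab₁
    · rw [abs_weighted_add_of_mul_nonneg hab₁ h₁.sin_nonneg h₁'.sin_nonneg] at hdef₁
      have e3 := abs_add_le a₁ b₁
      nlinarith [abs_nonneg a₁, abs_nonneg b₁]
    · have e3 := abs_weighted_sub_of_mul_nonpos hab₁ h₁.cos_nonneg h₁'.cos_nonneg
      rw [hsum] at e3
      have e4 := abs_add_le a b
      have e5 : |a₁ + b₁| ≤ |a₁ * s₁ + b₁ * σ₁| + |a₁ * (1 - s₁) + b₁ * (1 - σ₁)| := by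
        refine le_trans (le_of_eq ?_) (abs_add_le _ _)
        congr 1
        ring
      have e6 := abs_weighted_add_le (a := a₁) (b := b₁) (sub_nonneg.2 h₁.sin_le_one)
        (sub_nonneg.2 h₁'.sin_le_one)
      have e7 := mul_le_mul_of_nonneg_left h₁.one_sub_le (abs_nonneg a₁)
      have e8 := mul_le_mul_of_nonneg_left h₁'.one_sub_le (abs_nonneg b₁)
      linarith

/-- Angles admitted by the Jacobi method. -/
abbrev jacobiRange : Set ℝ := Set.Icc (-(Real.pi / 4)) (Real.pi / 4)

section Angles

variable {φ ψ : ℝ}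

lemma cos_two_mul_nonneg (h : φ ∈ jacobiRange) : 0 ≤ Real.cos (2 * φ) :=
  Real.cos_nonneg_of_mem_Icc ⟨by linarith [h.1], by linarith [h.2]⟩

lemma neg_mem_jacobiRange (h : φ ∈ jacobiRange) : -φ ∈ jacobiRange :=
  ⟨by linarith [h.2], by linarith [h.1]⟩

lemma cos_add_nonneg (hφ : φ ∈ jacobiRange) (hψ : ψ ∈ jacobiRange) : 0 ≤ Real.cos (φ + ψ) :=
  Real.cos_nonneg_of_mem_Icc ⟨by linarith [hφ.1, hψ.1], by linarith [hφ.2, hψ.2]⟩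

lemma cos_two_mul_add_cos_two_mul :
    Real.cos (2 * φ) + Real.cos (2 * ψ) = 2 * (Real.cos (φ + ψ) * Real.cos (φ - ψ)) := by
  rw [show 2 * φ = (φ + ψ) + (φ - ψ) by ring, show 2 * ψ = (φ + ψ) - (φ - ψ) by ring,
    Real.cos_add (φ + ψ), Real.cos_sub (φ + ψ)]
  ring

lemma half_le_cos_sq (hφ : φ ∈ jacobiRange) : 1 / 2 ≤ Real.cos φ ^ 2 := by
  have := cos_two_mul_nonneg hφ
  rw [Real.cos_two_mul] at this
  linarith

lemma one_le_cos_add_add_cos_sub (hφ : φ ∈ jacobiRange) (hψ : ψ ∈ jacobiRange) :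
    1 ≤ Real.cos (φ + ψ) + Real.cos (φ - ψ) := by
  have h1 := half_le_cos_sq hφ
  have h2 := half_le_cos_sq hψ
  have hpi := Real.pi_pos
  have p1 : 0 ≤ Real.cos φ :=
    Real.cos_nonneg_of_mem_Icc ⟨by linarith [hφ.1], by linarith [hφ.2]⟩
  have p2 : 0 ≤ Real.cos ψ :=
    Real.cos_nonneg_of_mem_Icc ⟨by linarith [hψ.1], by linarith [hψ.2]⟩
  rw [Real.cos_add, Real.cos_sub]
  have : (1 / 2) ^ 2 ≤ (Real.cos φ * Real.cos ψ) ^ 2 := by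
    rw [mul_pow]; nlinarith
  have := abs_le_of_sq_le_sq' this (mul_nonneg p1 p2)
  linarith [this.2]

/-- For Jacobi angles `|φ + ψ| + |φ - ψ| ≤ π/2`. -/
lemma sin_sub_sq_le_cos_add_sq (hφ : φ ∈ jacobiRange) (hψ : ψ ∈ jacobiRange) :
    Real.sin (φ - ψ) ^ 2 ≤ Real.cos (φ + ψ) ^ 2 := by
  have h : 0 ≤ Real.cos (2 * φ) * Real.cos (2 * ψ) :=
    mul_nonneg (cos_two_mul_nonneg hφ) (cos_two_mul_nonneg hψ)
  rw [show 2 * φ = (φ + ψ) + (φ - ψ) by ring, show 2 * ψ = (φ + ψ) - (φ - ψ) by ring,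
    Real.cos_add (φ + ψ), Real.cos_sub (φ + ψ)] at h
  nlinarith [Real.sin_sq_add_cos_sq (φ + ψ), Real.sin_sq_add_cos_sq (φ - ψ)]

lemma abs_sin_sub_le_cos_add (hφ : φ ∈ jacobiRange) (hψ : ψ ∈ jacobiRange) :
    |Real.sin (φ - ψ)| ≤ Real.cos (φ + ψ) :=
  abs_le_of_sq_le_sq (sin_sub_sq_le_cos_add_sq hφ hψ) (cos_add_nonneg hφ hψ)

lemma sin_two_mul_mul_sin_two_mul :
    Real.sin (2 * φ) * Real.sin (2 * ψ) = Real.cos (φ - ψ) ^ 2 - Real.cos (φ + ψ) ^ 2 := by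
  rw [show 2 * φ = (φ + ψ) + (φ - ψ) by ring, show 2 * ψ = (φ + ψ) - (φ - ψ) by ring,
    Real.sin_add (φ + ψ), Real.sin_sub (φ + ψ)]
  nlinarith [Real.sin_sq_add_cos_sq (φ + ψ), Real.sin_sq_add_cos_sq (φ - ψ)]

/-- The two rotations of a stage are nearly `π/4` with the same sign, and the small and the
large combination of the entries that they mix are `z` and `y`. -/
structure NearQuarter (φ ψ y z : ℝ) : Prop where
  cos_le : Real.cos (φ + ψ) ≤ 1 / 40
  abs_le : |z| ≤ |y| / 40
  pos : 0 < |y|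

lemma nearQuarter_of_half_le {y z : ℝ}
    (hpos : 0 < y ^ 2 + z ^ 2)
    (hle : Real.cos (φ + ψ) ^ 2 * y ^ 2 + Real.cos (φ - ψ) ^ 2 * z ^ 2
      ≤ 1 / 10000 * (y ^ 2 + z ^ 2))
    (hhalf : 1 / 2 ≤ Real.cos (φ - ψ)) : NearQuarter φ ψ y z := by
  have h1 : 1 / 4 ≤ Real.cos (φ - ψ) ^ 2 := by nlinarith
  have h2 : 1 / 4 * z ^ 2 ≤ Real.cos (φ - ψ) ^ 2 * z ^ 2 :=
    mul_le_mul_of_nonneg_right h1 (sq_nonneg z)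
  have h3 : 0 ≤ Real.cos (φ + ψ) ^ 2 * y ^ 2 := by positivity
  have hz : z ^ 2 ≤ (|y| / 40) ^ 2 := by rw [div_pow, sq_abs]; linarith
  have hy : 0 < y ^ 2 := by
    rw [div_pow, sq_abs] at hz
    linarith
  refine ⟨?_, abs_le_of_sq_le_sq hz (by positivity), abs_pos.2 (by rintro rfl; simp at hy)⟩
  have hc : Real.cos (φ + ψ) ^ 2 ≤ (1 / 40) ^ 2 := by
    refine le_of_mul_le_mul_right ?_ hy
    rw [div_pow, sq_abs] at hz
    nlinarith
  exact (abs_le_of_sq_le_sq' hc (by norm_num)).2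

lemma NearQuarter.or_of_le (hφ : φ ∈ jacobiRange) (hψ : ψ ∈ jacobiRange) {y z : ℝ}
    (hpos : 0 < y ^ 2 + z ^ 2)
    (hle : Real.cos (φ + ψ) ^ 2 * y ^ 2 + Real.cos (φ - ψ) ^ 2 * z ^ 2
      ≤ 1 / 10000 * (y ^ 2 + z ^ 2)) :
    NearQuarter φ ψ y z ∨ NearQuarter φ (-ψ) z y := by
  have h := one_le_cos_add_add_cos_sub hφ hψ
  rcases le_total (1 / 2) (Real.cos (φ - ψ)) with h1 | h1
  · exact .inl (nearQuarter_of_half_le hpos hle h1)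
  · refine .inr (nearQuarter_of_half_le (by linarith) ?_ ?_)
    · rw [sub_neg_eq_add, ← sub_eq_add_neg]
      linarith
    · rw [sub_neg_eq_add]
      linarith

variable {y z : ℝ}

lemma NearQuarter.cos_two_mul_le (h : NearQuarter φ ψ y z) (hφ : φ ∈ jacobiRange)
    (hψ : ψ ∈ jacobiRange) :
    Real.cos (2 * φ) ≤ 1 / 20 ∧ Real.cos (2 * ψ) ≤ 1 / 20 := by
  have h1 := cos_two_mul_add_cos_two_mul (φ := φ) (ψ := ψ)
  have h2 := cos_two_mul_nonneg hφ
  have h3 := cos_two_mul_nonneg hψ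
  have h4 : Real.cos (φ + ψ) * Real.cos (φ - ψ) ≤ 1 / 40 * 1 :=
    mul_le_mul h.cos_le (Real.cos_le_one _)
      (by rw [sub_eq_add_neg]; exact cos_add_nonneg hφ (neg_mem_jacobiRange hψ)) (by norm_num)
  constructor <;> linarith

lemma NearQuarter.sin_mul_sin_nonneg (h : NearQuarter φ ψ y z) (hφ : φ ∈ jacobiRange)
    (hψ : ψ ∈ jacobiRange) : 0 ≤ Real.sin (2 * φ) * Real.sin (2 * ψ) := by
  rw [sin_two_mul_mul_sin_two_mul]
  have h1 := one_le_cos_add_add_cos_sub hφ hψ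
  have h2 := cos_add_nonneg hφ hψ
  have := h.cos_le
  nlinarith

lemma NearQuarter.angle_ne_zero (h : NearQuarter φ ψ y z) : φ ≠ 0 ∨ ψ ≠ 0 := by
  by_contra! hc
  have := h.cos_le
  rw [hc.1, hc.2, add_zero, Real.cos_zero] at this
  norm_num at this

lemma NearQuarter.half_le_abs_sin (h : NearQuarter φ ψ y z) (hφ : φ ∈ jacobiRange)
    (hψ : ψ ∈ jacobiRange) : 1 / 2 ≤ |Real.sin (φ + ψ)| := by
  have h1 := Real.sin_sq_add_cos_sq (φ + ψ)
  have h2 := cos_add_nonneg hφ hψ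
  have h3 := h.cos_le
  refine abs_le_of_sq_le_sq (a := 1 / 2) ?_ (abs_nonneg _) |> (le_trans (le_abs_self _) ·)
  rw [sq_abs]
  nlinarith

end Angles

/-- A stage of the method: two commuting rotations by the angles `φ` and `ψ`, which leave the
differences `r₁`, `r₂` of the diagonal entries they act on, and the sum `y` and difference `z` of
the two nonzero entries that are not annihilated. -/
structure Stage where
  φ : ℝ
  ψ : ℝ
  r₁ : ℝ
  r₂ : ℝ
  y : ℝ
  z : ℝ

namespace Stage

/-- Twice the first pivot. -/
noncomputable def pivot₁ (s : Stage) : ℝ := s.r₁ * Real.sin (2 * s.φ)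

/-- Twice the second pivot. -/
noncomputable def pivot₂ (s : Stage) : ℝ := s.r₂ * Real.sin (2 * s.ψ)

/-- The square of the off-norm. -/
noncomputable def energy (s : Stage) : ℝ :=
  (s.pivot₁ ^ 2 + s.pivot₂ ^ 2) / 4 + (s.y ^ 2 + s.z ^ 2) / 2

/-- The angles of the stage are Jacobi angles. -/
structure Valid (s : Stage) : Prop where
  φ_mem : s.φ ∈ jacobiRange
  ψ_mem : s.ψ ∈ jacobiRange
  φ_eq_zero : s.pivot₁ = 0 → s.φ = 0
  ψ_eq_zero : s.pivot₂ = 0 → s.ψ = 0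

/-- The relations between consecutive stages. -/
structure Follows (s t : Stage) : Prop where
  abs_pivot_add : |t.pivot₁ + t.pivot₂| = 2 * Real.cos (s.φ + s.ψ) * |s.y|
  abs_pivot_sub : |t.pivot₁ - t.pivot₂| = 2 * Real.cos (s.φ - s.ψ) * |s.z|
  abs_y : |t.y| = |Real.sin (s.φ - s.ψ)| * |s.z|
  abs_z : |t.z| = |Real.sin (s.φ + s.ψ)| * |s.y|

/-- The stage that arises by changing the sign of one basis vector. -/
def mirror (s : Stage) : Stage := ⟨s.φ, -s.ψ, s.r₁, s.r₂, s.z, s.y⟩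

variable {s t : Stage}

lemma pivot₁_mirror : s.mirror.pivot₁ = s.pivot₁ := rfl

lemma pivot₂_mirror : s.mirror.pivot₂ = -s.pivot₂ := by
  simp [pivot₂, mirror]

lemma Valid.mirror (h : s.Valid) : s.mirror.Valid where
  φ_mem := h.φ_mem
  ψ_mem := neg_mem_jacobiRange h.ψ_mem
  φ_eq_zero := h.φ_eq_zero
  ψ_eq_zero h0 := by
    rw [pivot₂_mirror, neg_eq_zero] at h0
    simp [Stage.mirror, h.ψ_eq_zero h0]

lemma Follows.mirror (h : s.Follows t) : s.mirror.Follows t.mirror where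
  abs_pivot_add := by
    rw [pivot₁_mirror, pivot₂_mirror, ← sub_eq_add_neg, h.abs_pivot_sub]; rfl
  abs_pivot_sub := by
    rw [pivot₁_mirror, pivot₂_mirror, sub_neg_eq_add, h.abs_pivot_add]
    simp [Stage.mirror]
  abs_y := by simpa [Stage.mirror] using h.abs_z
  abs_z := h.abs_y

/-- Both angles are nearly `π/4` with the same sign. -/
def Aligned (s : Stage) : Prop := NearQuarter s.φ s.ψ s.y s.z

/-- Both angles are nearly `±π/4`. -/
def Slow (s : Stage) : Prop := s.Aligned ∨ s.mirror.Aligned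

lemma mirror_mirror : s.mirror.mirror = s := by
  simp [mirror]

lemma Slow.mirror (h : s.Slow) : s.mirror.Slow := by
  rw [Slow, mirror_mirror]
  exact h.symm

/-- The total size of the two diagonal gaps after the stage. -/
def gap (s : Stage) : ℝ := |s.r₁| + |s.r₂|

/-- The smaller of the two combinations `y`, `z`. -/
noncomputable def small (s : Stage) : ℝ := min |s.y| |s.z|

/-- The pivots up to sign: their sum or their difference. -/
noncomputable def defect (s : Stage) : ℝ :=
  |(s.r₁ * |Real.sin (2 * s.φ)| + s.r₂ * |Real.sin (2 * s.ψ)|)|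

lemma defect_mirror : s.mirror.defect = s.defect := by
  simp [defect, mirror]

lemma small_mirror : s.mirror.small = s.small := min_comm _ _

lemma Aligned.small_eq (h : s.Aligned) : s.small = |s.z| :=
  min_eq_right (h.abs_le.trans (by linarith [h.pos]))

lemma Slow.nearRightAngle (h : s.Slow) (hs : s.Valid) :
    NearRightAngle (Real.cos (2 * s.φ)) |Real.sin (2 * s.φ)| ∧
      NearRightAngle (Real.cos (2 * s.ψ)) |Real.sin (2 * s.ψ)| := by
  have key : Real.cos (2 * s.φ) ≤ 1 / 20 ∧ Real.cos (2 * s.ψ) ≤ 1 / 20 := by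
    rcases h with h | h
    · exact h.cos_two_mul_le hs.φ_mem hs.ψ_mem
    · simpa [Stage.mirror] using NearQuarter.cos_two_mul_le h hs.φ_mem hs.mirror.ψ_mem
  refine ⟨⟨cos_two_mul_nonneg hs.φ_mem, key.1, abs_nonneg _, ?_⟩,
    ⟨cos_two_mul_nonneg hs.ψ_mem, key.2, abs_nonneg _, ?_⟩⟩ <;>
  rw [sq_abs, Real.sin_sq_add_cos_sq]

lemma Slow.gap_ne_zero (h : s.Slow) (hs : s.Valid) : s.gap ≠ 0 := by
  intro h0
  have h1 : s.r₁ = 0 := abs_eq_zero.1 (by linarith [abs_nonneg s.r₁, abs_nonneg s.r₂, h0.le,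
    show s.gap = |s.r₁| + |s.r₂| from rfl])
  have h2 : s.r₂ = 0 := abs_eq_zero.1 (by linarith [abs_nonneg s.r₁, abs_nonneg s.r₂, h0.le,
    show s.gap = |s.r₁| + |s.r₂| from rfl])
  have h3 := hs.φ_eq_zero (by simp [pivot₁, h1])
  have h4 := hs.ψ_eq_zero (by simp [pivot₂, h2])
  rcases h with h | h
  · exact (NearQuarter.angle_ne_zero h).elim (· h3) (· h4)
  · exact (NearQuarter.angle_ne_zero h).elim (· h3) (· (by simp [Stage.mirror, h4]))

lemma Aligned.mirror_aligned_of_follows (h : s.Aligned) (hs : s.Valid) (hst : s.Follows t)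
    (ht : t.Slow) : t.mirror.Aligned := by
  refine ht.resolve_left fun h' => ?_
  have h1 := h'.abs_le
  have h2 := NearQuarter.half_le_abs_sin h hs.φ_mem hs.ψ_mem
  have h3 := Real.abs_sin_le_one (s.φ - s.ψ)
  rw [hst.abs_z, hst.abs_y] at h1
  have h4 := h.abs_le
  have h5 := h.pos
  have h6 := mul_le_mul_of_nonneg_right h2 h5.le
  have h7 := mul_le_mul_of_nonneg_right h3 (abs_nonneg s.z)
  linarith

lemma abs_pivot_add_le (t : Stage) : |t.pivot₁ + t.pivot₂| ≤ t.gap := by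
  refine (abs_add_le _ _).trans (add_le_add ?_ ?_)
  · rw [pivot₁, abs_mul]
    exact mul_le_of_le_one_right (abs_nonneg _) (Real.abs_sin_le_one _)
  · rw [pivot₂, abs_mul]
    exact mul_le_of_le_one_right (abs_nonneg _) (Real.abs_sin_le_one _)

lemma abs_mul_abs_add_mul_abs_of_nonpos {a b p q : ℝ} (h : p * q ≤ 0) :
    |(a * |p| + b * |q|)| = |a * p - b * q| := by
  rcases le_or_gt 0 p with hp | hp <;> rcases le_or_gt 0 q with hq | hq
  · rcases mul_eq_zero.1 (le_antisymm h (mul_nonneg hp hq)) with h0 | h0 <;>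
      simp [h0]
  · rw [abs_of_nonneg hp, abs_of_neg hq]
    ring_nf
  · rw [abs_of_neg hp, abs_of_nonneg hq, ← abs_neg]
    ring_nf
  · exact absurd (mul_pos_of_neg_of_neg hp hq) (not_lt.2 h)

lemma Aligned.transfer (h : s.Aligned) (hs : s.Valid) (ht : t.Valid) (hst : s.Follows t)
    (ht' : t.Slow) :
    t.small ≤ t.gap / 80 ∧ t.small ≤ s.small ∧
      t.defect ≤ 2 * s.small := by
  have hm := h.mirror_aligned_of_follows hs hst ht'
  have e1 : t.small = |t.y| := by rw [← small_mirror, hm.small_eq]; rfl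
  have c0 := cos_add_nonneg hs.φ_mem hs.ψ_mem
  have c1 := abs_sin_sub_le_cos_add hs.φ_mem hs.ψ_mem
  have e2 := t.abs_pivot_add_le
  rw [hst.abs_pivot_add] at e2
  rw [e1, h.small_eq]
  have e3 : |t.y| ≤ Real.cos (s.φ + s.ψ) * |s.z| := by
    rw [hst.abs_y]
    exact mul_le_mul_of_nonneg_right c1 (abs_nonneg _)
  refine ⟨?_, ?_, ?_⟩
  · have := mul_le_mul_of_nonneg_left h.abs_le c0
    linarith
  · exact e3.trans (mul_le_of_le_one_left (abs_nonneg _) (Real.cos_le_one _))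
  · have e4 : Real.sin (2 * t.φ) * Real.sin (2 * t.ψ) ≤ 0 := by
      simpa [Stage.mirror] using
        NearQuarter.sin_mul_sin_nonneg hm ht.mirror.φ_mem ht.mirror.ψ_mem
    rw [defect, abs_mul_abs_add_mul_abs_of_nonpos e4]
    change |t.pivot₁ - t.pivot₂| ≤ _
    rw [hst.abs_pivot_sub, mul_assoc]
    have := mul_le_of_le_one_left (abs_nonneg s.z) (Real.cos_le_one (s.φ - s.ψ))
    linarith

lemma Slow.transfer (h : s.Slow) (hs : s.Valid) (ht : t.Valid) (hst : s.Follows t)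
    (ht' : t.Slow) :
    t.small ≤ t.gap / 80 ∧ t.small ≤ s.small ∧
      t.defect ≤ 2 * s.small := by
  rcases h with h | h
  · exact h.transfer hs ht hst ht'
  · have := h.transfer hs.mirror ht.mirror hst.mirror ht'.mirror
    rwa [small_mirror, small_mirror, defect_mirror] at this

lemma slow_of_energy_le (hs : s.Valid) (hst : s.Follows t) (hpos : 0 < s.energy)
    (hle : (s.pivot₁ ^ 2 + s.pivot₂ ^ 2) / 4 + (t.pivot₁ ^ 2 + t.pivot₂ ^ 2) / 4
      ≤ 1 / 10000 * s.energy) : s.Slow := by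
  have e : t.pivot₁ ^ 2 + t.pivot₂ ^ 2 = 2 * (Real.cos (s.φ + s.ψ) ^ 2 * s.y ^ 2 +
      Real.cos (s.φ - s.ψ) ^ 2 * s.z ^ 2) := by
    have e1 := congrArg (· ^ 2) hst.abs_pivot_add
    have e2 := congrArg (· ^ 2) hst.abs_pivot_sub
    simp only [mul_pow, sq_abs] at e1 e2
    linarith
  have p1 := sq_nonneg s.pivot₁
  have p2 := sq_nonneg s.pivot₂
  have p3 := sq_nonneg t.pivot₁
  have p4 := sq_nonneg t.pivot₂
  unfold energy at hpos hle
  refine NearQuarter.or_of_le hs.φ_mem hs.ψ_mem ?_ ?_ <;> linarith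

lemma Follows.energy_eq (hst : s.Follows t) :
    t.energy = s.energy - (s.pivot₁ ^ 2 + s.pivot₂ ^ 2) / 4 := by
  have e1 := congrArg (· ^ 2) hst.abs_pivot_add
  have e2 := congrArg (· ^ 2) hst.abs_pivot_sub
  have e3 := congrArg (· ^ 2) hst.abs_y
  have e4 := congrArg (· ^ 2) hst.abs_z
  simp only [mul_pow, sq_abs] at e1 e2 e3 e4
  have t1 := Real.sin_sq (s.φ + s.ψ)
  have t2 := Real.sin_sq (s.φ - s.ψ)
  unfold energy
  rw [e3, e4, t1, t2]
  linarith

/-- A sequence of stages, with the relations between the diagonal gaps. -/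
structure IsRun (s : ℕ → Stage) : Prop where
  valid : ∀ m, (s m).Valid
  follows : ∀ m, (s m).Follows (s (m + 1))
  gap_sub : ∀ m, (s (m + 1)).r₁ * Real.cos (2 * (s (m + 1)).φ) -
    (s (m + 1)).r₂ * Real.cos (2 * (s (m + 1)).ψ) = (s m).r₁ + (s m).r₂
  gap_add : ∀ m, (s (m + 2)).r₁ * Real.cos (2 * (s (m + 2)).φ) +
    (s (m + 2)).r₂ * Real.cos (2 * (s (m + 2)).ψ) = (s m).r₁ - (s m).r₂

lemma IsRun.not_slow {s : ℕ → Stage} (h : IsRun s) : ∃ m ≤ 4, ¬ (s m).Slow := by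
  by_contra! hslow
  have tr : ∀ m ≤ 3, _ := fun m hm => (hslow m (by omega)).transfer (h.valid m)
    (h.valid (m + 1)) (h.follows m) (hslow (m + 1) (by omega))
  have ang : ∀ m ≤ 4, _ := fun m hm => (hslow m hm).nearRightAngle (h.valid m)
  have def₁ : ∀ k, 1 ≤ k → k ≤ 3 → (s (k + 1)).defect ≤ (|(s k).r₁| + |(s k).r₂|) / 40 := by
    intro k hk hk'
    obtain ⟨k, rfl⟩ := Nat.exists_eq_add_of_le' hk
    have h1 := (tr k (by omega)).1
    have h2 := (tr (k + 1) hk').2.2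
    rw [gap] at h1
    linarith
  have def₂ : ∀ k, 1 ≤ k → k ≤ 2 → (s (k + 2)).defect ≤ (|(s k).r₁| + |(s k).r₂|) / 40 := by
    intro k hk hk'
    obtain ⟨k, rfl⟩ := Nat.exists_eq_add_of_le' hk
    have h1 := (tr k (by omega)).1
    have h2 := (tr (k + 1) (by omega)).2.1
    have h3 := (tr (k + 2) (by omega)).2.2
    rw [gap] at h1
    linarith
  have opp : ∀ k, 1 ≤ k → k ≤ 2 → 0 < (s k).r₁ * (s k).r₂ := by
    intro k hk hk'
    by_contra! hneg
    exact (hslow k (by omega)).gap_ne_zero (h.valid k)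
      (gap_eq_zero_of_opposite_signs (ang (k + 1) (by omega)).1 (ang (k + 1) (by omega)).2
        (ang (k + 2) (by omega)).1 (ang (k + 2) (by omega)).2 (h.gap_sub k) (h.gap_sub (k + 1))
        (h.gap_add k) (def₁ k hk (by omega)) (def₂ k hk hk') hneg)
  exact (hslow 1 (by omega)).gap_ne_zero (h.valid 1)
    (gap_eq_zero_of_same_signs (ang 2 (by omega)).1 (ang 2 (by omega)).2 (h.gap_sub 1)
      (def₁ 1 le_rfl (by omega)) (opp 1 le_rfl (by omega)).le (opp 2 (by omega) le_rfl).le)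

lemma energy_nonneg (s : Stage) : 0 ≤ s.energy := by
  unfold energy
  positivity

lemma IsRun.energy_antitone {s : ℕ → Stage} (h : IsRun s) : Antitone fun m => (s m).energy :=
  antitone_nat_of_succ_le fun m => by
    rw [(h.follows m).energy_eq]
    nlinarith [sq_nonneg (s m).pivot₁, sq_nonneg (s m).pivot₂]

/-- Six stages reduce the energy by a fixed factor. -/
lemma IsRun.energy_six_le {s : ℕ → Stage} (h : IsRun s) :
    (s 6).energy ≤ (1 - 1 / 10 ^ 5) ^ 2 * (s 0).energy := by
  by_contra! hlt
  obtain ⟨m, hm, hns⟩ := h.not_slow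
  have h0 := (s 0).energy_nonneg
  have a1 : (s m).energy ≤ (s 0).energy := h.energy_antitone (Nat.zero_le m)
  have a2 : (s 6).energy ≤ (s (m + 1 + 1)).energy := h.energy_antitone (by omega)
  have a3 : (s 6).energy ≤ (s m).energy := h.energy_antitone (by omega)
  have e1 := (h.follows m).energy_eq
  have e2 := (h.follows (m + 1)).energy_eq
  refine hns (slow_of_energy_le (h.valid m) (h.follows m) ?_ ?_)
  · refine lt_of_lt_of_le (lt_of_le_of_lt ?_ hlt) a3
    positivity
  · norm_num at hlt
    linarith

end Stage

/-! ### The effect of a Jacobi step on the entries of a matrix -/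

section Rotation

variable {n : ℕ}

lemma sum_mul_planeRotation (p : PivotPair n) (φ : ℝ) (f : Fin n → ℝ) (s : Fin n) :
    ∑ r, f r * planeRotation p φ r s =
      if s = p.1.1 then f p.1.1 * Real.cos φ + f p.1.2 * Real.sin φ
      else if s = p.1.2 then -f p.1.1 * Real.sin φ + f p.1.2 * Real.cos φ else f s := by
  have hne : p.1.1 ≠ p.1.2 := p.2.ne
  split_ifs with h1 h2
  · subst h1
    rw [Fintype.sum_eq_add _ _ hne]
    · simp [planeRotation, hne, hne.symm]
    · rintro x ⟨hx, hx'⟩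
      simp [planeRotation, hx, hx']
  · subst h2
    rw [Fintype.sum_eq_add _ _ hne]
    · simp [planeRotation, hne.symm]
    · rintro x ⟨hx, hx'⟩
      simp [planeRotation, hx, hx']
  · rw [Fintype.sum_eq_single s]
    · simp [planeRotation, h1, h2]
    · intro x hx
      simp [planeRotation, hx, h1, h2]

/-- `B` arises from the symmetric matrix `A` by a Jacobi step with the angle `φ` in the plane of
the distinct indices `i` and `j`, in either order. -/
structure JacobiStep (A B : Matrix (Fin n) (Fin n) ℝ) (i j : Fin n) (φ : ℝ) : Prop where
  mem : φ ∈ jacobiRange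
  angle : Real.sin (2 * φ) * (A i i - A j j) = 2 * A i j * Real.cos (2 * φ)
  degenerate : A i j = 0 → A i i = A j j → φ = 0
  symm : B.IsSymm
  apply_fst : B i i = Real.cos φ ^ 2 * A i i + 2 * Real.cos φ * Real.sin φ * A i j +
    Real.sin φ ^ 2 * A j j
  apply_snd : B j j = Real.sin φ ^ 2 * A i i - 2 * Real.cos φ * Real.sin φ * A i j +
    Real.cos φ ^ 2 * A j j
  apply_pivot : B i j = 0
  row_fst : ∀ k, k ≠ i → k ≠ j → B i k = Real.cos φ * A i k + Real.sin φ * A j k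
  row_snd : ∀ k, k ≠ i → k ≠ j → B j k = -Real.sin φ * A i k + Real.cos φ * A j k
  apply_of_ne : ∀ k l, k ≠ i → k ≠ j → l ≠ i → l ≠ j → B k l = A k l

variable {A B : Matrix (Fin n) (Fin n) ℝ}

lemma jacobiStep_of_isJacobiAngle {p : PivotPair n} {φ : ℝ} (hA : A.IsSymm)
    (hφ : IsJacobiAngle A p φ)
    (hB : B = (planeRotation p φ).transpose * A * planeRotation p φ) :
    JacobiStep A B p.1.1 p.1.2 φ := by
  obtain ⟨hmem, hang, hdeg⟩ := hφ
  have hne : p.1.1 ≠ p.1.2 := p.2.ne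
  have hsym : A p.1.2 p.1.1 = A p.1.1 p.1.2 := hA.apply _ _
  have hrow : ∀ r s, ((planeRotation p φ).transpose * A) r s =
      ∑ x, A s x * planeRotation p φ x r := fun r s => by
    simp only [Matrix.mul_apply, Matrix.transpose_apply]
    exact Finset.sum_congr rfl fun x _ => by rw [mul_comm, hA.apply]
  have hent : ∀ r s, B r s = ∑ x, ((planeRotation p φ).transpose * A) r x *
      planeRotation p φ x s := fun r s => by rw [hB, Matrix.mul_apply]
  simp only [sum_mul_planeRotation] at hrow hent
  refine ⟨hmem, hang, hdeg, ?_, ?_, ?_, ?_, ?_, ?_, ?_⟩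
  · rw [hB, Matrix.IsSymm, Matrix.transpose_mul, Matrix.transpose_mul, hA.eq,
      Matrix.transpose_transpose, Matrix.mul_assoc]
  · simp only [hent, hrow, if_true, hsym]
    ring
  · simp only [hent, hrow, if_true, hne.symm, if_false, hsym]
    ring
  · simp only [hent, hrow, if_true, hne.symm, if_false, hsym]
    rw [Real.sin_two_mul, Real.cos_two_mul'] at hang
    linarith
  · intro k hi hj
    simp only [hent, hrow, if_true, hi, hj, if_false, hA.apply]
    rw [← hA.apply k, ← hA.apply k]
    ring
  · intro k hi hj
    simp only [hent, hrow, if_true, hne.symm, hi, hj, if_false, hA.apply]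
    rw [← hA.apply k, ← hA.apply k]
    ring
  · intro k l hi hj hi' hj'
    simp only [hent, hrow, hi, hj, hi', hj', if_false]
    exact hA.apply _ _

lemma JacobiStep.swap {i j : Fin n} {φ : ℝ} (hA : A.IsSymm) (h : JacobiStep A B i j φ) :
    JacobiStep A B j i (-φ) where
  mem := neg_mem_jacobiRange h.mem
  angle := by
    rw [mul_neg, Real.sin_neg, Real.cos_neg, hA.apply i j]
    linarith [h.angle]
  degenerate h1 h2 := by rw [h.degenerate (by rw [← hA.apply, h1]) h2.symm, neg_zero]
  symm := h.symm
  apply_fst := by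
    rw [h.apply_snd, Real.sin_neg, Real.cos_neg, hA.apply i j]
    ring
  apply_snd := by
    rw [h.apply_fst, Real.sin_neg, Real.cos_neg, hA.apply i j]
    ring
  apply_pivot := by rw [h.symm.apply, h.apply_pivot]
  row_fst k hj hi := by
    rw [h.row_snd k hi hj, Real.sin_neg, Real.cos_neg]
    ring
  row_snd k hj hi := by
    rw [h.row_fst k hi hj, Real.sin_neg, Real.cos_neg]
    ring
  apply_of_ne k l h1 h2 h3 h4 := h.apply_of_ne k l h2 h1 h4 h3

variable {i j : Fin n} {φ : ℝ}

lemma JacobiStep.sub_eq (h : JacobiStep A B i j φ) :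
    B i i - B j j = Real.cos (2 * φ) * (A i i - A j j) + Real.sin (2 * φ) * (2 * A i j) := by
  rw [h.apply_fst, h.apply_snd, Real.cos_two_mul', Real.sin_two_mul]
  ring

lemma JacobiStep.add_eq (h : JacobiStep A B i j φ) : B i i + B j j = A i i + A j j := by
  rw [h.apply_fst, h.apply_snd]
  linear_combination (A i i + A j j) * Real.sin_sq_add_cos_sq φ

lemma JacobiStep.gap_eq (h : JacobiStep A B i j φ) :
    A i i - A j j = (B i i - B j j) * Real.cos (2 * φ) := by
  rw [h.sub_eq]
  linear_combination -(A i i - A j j) * Real.sin_sq_add_cos_sq (2 * φ) +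
    Real.sin (2 * φ) * h.angle

lemma JacobiStep.pivot_eq (h : JacobiStep A B i j φ) :
    2 * A i j = (B i i - B j j) * Real.sin (2 * φ) := by
  rw [h.sub_eq]
  linear_combination -(2 * A i j) * Real.sin_sq_add_cos_sq (2 * φ) -
    Real.cos (2 * φ) * h.angle

lemma JacobiStep.angle_eq_zero (h : JacobiStep A B i j φ) (h0 : A i j = 0) : φ = 0 := by
  by_cases hd : A i i = A j j
  · exact h.degenerate h0 hd
  · have h1 := h.angle
    rw [h0, mul_zero, zero_mul] at h1
    have h2 := (mul_eq_zero.1 h1).resolve_right (sub_ne_zero.2 hd)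
    have hpi := Real.pi_pos
    have := (Real.sin_eq_zero_iff_of_lt_of_lt (by linarith [h.mem.1]) (by linarith [h.mem.2])).1 h2
    linarith

/-- The diagonal entries change by at most the modulus of the pivot. -/
lemma JacobiStep.abs_diag_sub_le (h : JacobiStep A B i j φ) : |B i i - A i i| ≤ |A i j| := by
  have e : 2 * (B i i - A i i) = (B i i - B j j) * (1 - Real.cos (2 * φ)) := by
    linear_combination h.add_eq - h.gap_eq
  have hc := cos_two_mul_nonneg h.mem
  have hc' := Real.cos_le_one (2 * φ)
  have hs := Real.sin_sq_add_cos_sq (2 * φ)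
  refine abs_le_of_sq_le_sq' (b := |A i j|) ?_ (abs_nonneg _) |> abs_le.2
  rw [sq_abs]
  have e2 : 4 * (B i i - A i i) ^ 2 = (B i i - B j j) ^ 2 * (1 - Real.cos (2 * φ)) ^ 2 := by
    rw [← mul_pow, ← e]; ring
  have e3 : 4 * A i j ^ 2 = (B i i - B j j) ^ 2 * Real.sin (2 * φ) ^ 2 := by
    rw [← mul_pow, ← h.pivot_eq]; ring
  have e4 := mul_le_mul_of_nonneg_left (a := (B i i - B j j) ^ 2)
    (show (1 - Real.cos (2 * φ)) ^ 2 ≤ Real.sin (2 * φ) ^ 2 by nlinarith) (sq_nonneg _)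
  linarith

lemma JacobiStep.abs_diag_sub_le_snd (hA : A.IsSymm) (h : JacobiStep A B i j φ) :
    |B j j - A j j| ≤ |A i j| := by
  rw [← hA.apply i j]
  exact (h.swap hA).abs_diag_sub_le

end Rotation

/-! ### Matrices of order 4 -/

section OrderFour

variable {A B C : Matrix (Fin 4) (Fin 4) ℝ} {φ ψ : ℝ}

/-- The square of the off-norm, in terms of an arbitrary labelling of the indices. -/
lemma offNorm_sq_eq (hA : A.IsSymm) (σ : Equiv.Perm (Fin 4)) :
    offNorm A ^ 2 = A (σ 0) (σ 1) ^ 2 + A (σ 0) (σ 2) ^ 2 + A (σ 0) (σ 3) ^ 2 +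
      A (σ 1) (σ 2) ^ 2 + A (σ 1) (σ 3) ^ 2 + A (σ 2) (σ 3) ^ 2 := by
  have half : ∀ X : Matrix (Fin 4) (Fin 4) ℝ, X.IsSymm →
      2 * (X 0 1 ^ 2 + X 0 2 ^ 2 + X 0 3 ^ 2 + X 1 2 ^ 2 + X 1 3 ^ 2 + X 2 3 ^ 2) =
        (∑ i, ∑ j, X i j ^ 2) - ∑ i, X i i ^ 2 := by
    intro X hX
    simp only [Fin.sum_univ_four]
    rw [hX.apply 0 1, hX.apply 0 2, hX.apply 0 3, hX.apply 1 2, hX.apply 1 3, hX.apply 2 3]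
    ring
  have h0 : offNorm A ^ 2 =
      A 0 1 ^ 2 + A 0 2 ^ 2 + A 0 3 ^ 2 + A 1 2 ^ 2 + A 1 3 ^ 2 + A 2 3 ^ 2 := by
    have i0 : Finset.Ioi (0 : Fin 4) = {1, 2, 3} := by decide
    have i1 : Finset.Ioi (1 : Fin 4) = {2, 3} := by decide
    have i2 : Finset.Ioi (2 : Fin 4) = {3} := by decide
    have i3 : Finset.Ioi (3 : Fin 4) = ∅ := by decide
    have hn : 0 ≤ ∑ i, ∑ j ∈ Finset.Ioi i, A i j ^ 2 := by positivity
    refine (Real.sq_sqrt hn).trans ?_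
    rw [Fin.sum_univ_four, i0, i1, i2, i3]
    simp [Finset.sum_insert]
    ring
  have h1 := half A hA
  have h2 := half (A.submatrix σ σ) (hA.submatrix σ)
  have h3 : ∑ i, ∑ j, A.submatrix σ σ i j ^ 2 = ∑ i, ∑ j, A i j ^ 2 := by
    rw [← Equiv.sum_comp σ fun i => ∑ j, A i j ^ 2]
    exact Finset.sum_congr rfl fun i _ => Equiv.sum_comp σ fun j => A (σ i) j ^ 2
  have h4 : ∑ i, A.submatrix σ σ i i ^ 2 = ∑ i, A i i ^ 2 :=
    Equiv.sum_comp σ fun i => A i i ^ 2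
  rw [h3, h4] at h2
  simp only [Matrix.submatrix_apply] at h2
  linarith

lemma offNorm_nonneg {n : ℕ} (X : Matrix (Fin n) (Fin n) ℝ) : 0 ≤ offNorm X := Real.sqrt_nonneg _

lemma exists_perm_apply_eq {i j : Fin 4} (h : i ≠ j) :
    ∃ σ : Equiv.Perm (Fin 4), σ 0 = i ∧ σ 1 = j := by
  revert i j
  decide

lemma abs_apply_le_offNorm (hA : A.IsSymm) {i j : Fin 4} (h : i ≠ j) : |A i j| ≤ offNorm A := by
  obtain ⟨σ, rfl, rfl⟩ := exists_perm_apply_eq h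
  refine abs_le_of_sq_le_sq' (b := offNorm A) ?_ (offNorm_nonneg A) |> abs_le.2
  rw [offNorm_sq_eq hA σ]
  nlinarith [sq_nonneg (A (σ 0) (σ 2)), sq_nonneg (A (σ 0) (σ 3)), sq_nonneg (A (σ 1) (σ 2)),
    sq_nonneg (A (σ 1) (σ 3)), sq_nonneg (A (σ 2) (σ 3))]

lemma JacobiStep.offNorm_le (hA : A.IsSymm) {i j : Fin 4} (hij : i ≠ j)
    (h : JacobiStep A B i j φ) : offNorm B ≤ offNorm A := by
  obtain ⟨σ, rfl, rfl⟩ := exists_perm_apply_eq hij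
  refine abs_le_of_sq_le_sq' (b := offNorm A) ?_ (offNorm_nonneg A) |>.2
  rw [offNorm_sq_eq hA σ, offNorm_sq_eq h.symm σ, h.apply_pivot,
    h.row_fst (σ 2) (by simp) (by simp), h.row_fst (σ 3) (by simp) (by simp),
    h.row_snd (σ 2) (by simp) (by simp), h.row_snd (σ 3) (by simp) (by simp),
    h.apply_of_ne (σ 2) (σ 3) (by simp) (by simp) (by simp) (by simp)]
  have hs := Real.sin_sq_add_cos_sq φ
  refine le_of_sub_nonneg (le_of_le_of_eq (sq_nonneg (A (σ 0) (σ 1))) ?_)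
  linear_combination (A (σ 0) (σ 2) ^ 2 + A (σ 0) (σ 3) ^ 2 + A (σ 1) (σ 2) ^ 2 +
    A (σ 1) (σ 3) ^ 2) * hs

end OrderFour

/-! ### Runs of the method under a parallel strategy -/

section ParallelRun

variable {A B C : Matrix (Fin 4) (Fin 4) ℝ} {φ ψ : ℝ}

/-- The entries after two commuting rotations in the planes `{a, c}` and `{b, d}`, if the entries
at `(a, b)` and `(c, d)` vanish. -/
structure StageEntries (A C : Matrix (Fin 4) (Fin 4) ℝ) (a b c d : Fin 4) (φ ψ : ℝ) : Prop where
  apply_ad : C a d = Real.cos φ * Real.cos ψ * A a d - Real.sin φ * Real.sin ψ * A c b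
  apply_cb : C c b = Real.cos φ * Real.cos ψ * A c b - Real.sin φ * Real.sin ψ * A a d
  apply_ab : C a b = Real.sin φ * Real.cos ψ * A c b + Real.cos φ * Real.sin ψ * A a d
  apply_dc : C d c = -(Real.cos φ * Real.sin ψ * A c b + Real.sin φ * Real.cos ψ * A a d)

/-- The differences of diagonal entries before and after two commuting rotations in the planes
`{a, c}` and `{b, d}`. -/
structure StageGaps (A C : Matrix (Fin 4) (Fin 4) ℝ) (a b c d : Fin 4) (φ ψ : ℝ) : Prop where
  φ_mem : φ ∈ jacobiRange
  ψ_mem : ψ ∈ jacobiRange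
  φ_eq_zero : A a c = 0 → φ = 0
  ψ_eq_zero : A b d = 0 → ψ = 0
  gap_ac : A a a - A c c = (C a a - C c c) * Real.cos (2 * φ)
  gap_bd : A b b - A d d = (C b b - C d d) * Real.cos (2 * ψ)
  pivot_ac : 2 * A a c = (C a a - C c c) * Real.sin (2 * φ)
  pivot_bd : 2 * A b d = (C b b - C d d) * Real.sin (2 * ψ)
  add_ac : C a a + C c c = A a a + A c c
  add_bd : C b b + C d d = A b b + A d d
  apply_ac : C a c = 0
  apply_db : C d b = 0

variable {σ : Equiv.Perm (Fin 4)}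

lemma stageGaps_of_jacobiStep (h₁ : JacobiStep A B (σ 0) (σ 2) φ)
    (h₂ : JacobiStep B C (σ 1) (σ 3) ψ) :
    StageGaps A C (σ 0) (σ 1) (σ 2) (σ 3) φ ψ := by
  have hB : ∀ k l, k ≠ 0 → k ≠ 2 → l ≠ 0 → l ≠ 2 → B (σ k) (σ l) = A (σ k) (σ l) :=
    fun k l h1 h2 h3 h4 => h₁.apply_of_ne _ _ (by simpa) (by simpa) (by simpa) (by simpa)
  have hC : ∀ k l, k ≠ 1 → k ≠ 3 → l ≠ 1 → l ≠ 3 → C (σ k) (σ l) = B (σ k) (σ l) :=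
    fun k l h1 h2 h3 h4 => h₂.apply_of_ne _ _ (by simpa) (by simpa) (by simpa) (by simpa)
  have b11 := hB 1 1 (by decide) (by decide) (by decide) (by decide)
  have b33 := hB 3 3 (by decide) (by decide) (by decide) (by decide)
  have b13 := hB 1 3 (by decide) (by decide) (by decide) (by decide)
  have c00 := hC 0 0 (by decide) (by decide) (by decide) (by decide)
  have c22 := hC 2 2 (by decide) (by decide) (by decide) (by decide)
  have c02 := hC 0 2 (by decide) (by decide) (by decide) (by decide)
  refine ⟨h₁.mem, h₂.mem, h₁.angle_eq_zero, fun h => h₂.angle_eq_zero (b13.trans h), ?_, ?_, ?_,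
    ?_, ?_, ?_, ?_, ?_⟩
  · rw [c00, c22, h₁.gap_eq]
  · rw [← b11, ← b33, h₂.gap_eq]
  · rw [c00, c22, h₁.pivot_eq]
  · rw [← b13, h₂.pivot_eq]
  · rw [c00, c22, h₁.add_eq]
  · rw [← b11, ← b33, h₂.add_eq]
  · rw [c02, h₁.apply_pivot]
  · rw [h₂.symm.apply, h₂.apply_pivot]

lemma stageEntries_of_jacobiStep (h₁ : JacobiStep A B (σ 0) (σ 2) φ)
    (h₂ : JacobiStep B C (σ 1) (σ 3) ψ) (h01 : A (σ 0) (σ 1) = 0) (h23 : A (σ 2) (σ 3) = 0) :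
    StageEntries A C (σ 0) (σ 1) (σ 2) (σ 3) φ ψ := by
  have b01 := h₁.row_fst (σ 1) (by simp) (by simp)
  have b03 := h₁.row_fst (σ 3) (by simp) (by simp)
  have b21 := h₁.row_snd (σ 1) (by simp) (by simp)
  have b23 := h₁.row_snd (σ 3) (by simp) (by simp)
  have c10 := h₂.row_fst (σ 0) (by simp) (by simp)
  have c12 := h₂.row_fst (σ 2) (by simp) (by simp)
  have c30 := h₂.row_snd (σ 0) (by simp) (by simp)
  have c32 := h₂.row_snd (σ 2) (by simp) (by simp)
  rw [h₁.symm.apply (σ 0) (σ 1), h₁.symm.apply (σ 0) (σ 3), b01, b03, h01, h23] at c10 c30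
  rw [h₁.symm.apply (σ 2) (σ 1), h₁.symm.apply (σ 2) (σ 3), b21, b23, h01, h23] at c12 c32
  constructor
  · rw [← h₂.symm.apply, c30]
    ring
  · rw [← h₂.symm.apply, c12]
    ring
  · rw [← h₂.symm.apply, c10]
    ring
  · rw [c32]
    ring

/-- The relabelling of the indices between consecutive stages. -/
def nextLabels : Equiv.Perm (Fin 4) := Equiv.swap 1 2 * Equiv.swap 2 3

/-- `A` is generated by rotations in the planes `{σ₀, σ₂}`, `{σ₁, σ₃}`, where the labelling `σ`
runs through the three parallel pairings of the indices. -/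
structure IsParallelRun (σ : ℕ → Equiv.Perm (Fin 4)) (A : ℕ → Matrix (Fin 4) (Fin 4) ℝ) :
    Prop where
  labels : ∀ m, σ (m + 1) = σ m * nextLabels
  symm : ∀ k, (A k).IsSymm
  step_even : ∀ m, ∃ φ, JacobiStep (A (2 * m)) (A (2 * m + 1)) (σ m 0) (σ m 2) φ
  step_odd : ∀ m, ∃ φ, JacobiStep (A (2 * m + 1)) (A (2 * m + 2)) (σ m 1) (σ m 3) φ

variable {σ : ℕ → Equiv.Perm (Fin 4)} {A : ℕ → Matrix (Fin 4) (Fin 4) ℝ}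

namespace IsParallelRun

lemma shift (h : IsParallelRun σ A) (k : ℕ) :
    IsParallelRun (fun m => σ (m + k)) fun m => A (m + 2 * k) where
  labels m := by
    rw [← h.labels, add_right_comm]
  symm m := h.symm _
  step_even m := by
    convert h.step_even (m + k) using 4 <;> ring
  step_odd m := by
    convert h.step_odd (m + k) using 4 <;> ring

lemma label_succ (h : IsParallelRun σ A) (m : ℕ) :
    σ (m + 1) 0 = σ m 0 ∧ σ (m + 1) 1 = σ m 2 ∧ σ (m + 1) 2 = σ m 3 ∧ σ (m + 1) 3 = σ m 1 := by
  rw [h.labels]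
  exact ⟨congrArg (σ m) (by decide), congrArg (σ m) (by decide), congrArg (σ m) (by decide),
    congrArg (σ m) (by decide)⟩

lemma exists_angles (h : IsParallelRun σ A) : ∃ φ ψ : ℕ → ℝ,
    (∀ m, StageGaps (A (2 * m)) (A (2 * (m + 1))) (σ m 0) (σ m 1) (σ m 2) (σ m 3)
      (φ m) (ψ m)) ∧
    ∀ m, A (2 * m) (σ m 0) (σ m 1) = 0 → A (2 * m) (σ m 2) (σ m 3) = 0 →
      StageEntries (A (2 * m)) (A (2 * (m + 1))) (σ m 0) (σ m 1) (σ m 2) (σ m 3)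
        (φ m) (ψ m) := by
  choose φ hφ using h.step_even
  choose ψ hψ using h.step_odd
  exact ⟨φ, ψ, fun m => stageGaps_of_jacobiStep (hφ m) (hψ m),
    fun m => stageEntries_of_jacobiStep (hφ m) (hψ m)⟩

lemma apply_eq_zero (h : IsParallelRun σ A) (m : ℕ) :
    A (2 * (m + 1)) (σ (m + 1) 0) (σ (m + 1) 1) = 0 ∧
      A (2 * (m + 1)) (σ (m + 1) 2) (σ (m + 1) 3) = 0 := by
  obtain ⟨φ, ψ, hg, -⟩ := h.exists_angles
  obtain ⟨l0, l1, l2, l3⟩ := h.label_succ m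
  rw [l0, l1, l2, l3]
  exact ⟨(hg m).apply_ac, (hg m).apply_db⟩

/-- Twelve steps reduce the off-norm by a fixed factor, once two entries vanish. -/
lemma offNorm_twelve_le (h : IsParallelRun σ A) (h01 : A 0 (σ 0 0) (σ 0 1) = 0)
    (h23 : A 0 (σ 0 2) (σ 0 3) = 0) :
    offNorm (A 12) ≤ (1 - 1 / 10 ^ 5) * offNorm (A 0) := by
  obtain ⟨φ, ψ, hg, he⟩ := h.exists_angles
  have hz : ∀ m, A (2 * m) (σ m 0) (σ m 1) = 0 ∧ A (2 * m) (σ m 2) (σ m 3) = 0 := by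
    rintro (_ | m)
    · exact ⟨h01, h23⟩
    · exact h.apply_eq_zero m
  replace he := fun m => he m (hz m).1 (hz m).2
  let s : ℕ → Stage := fun m =>
    { φ := φ m
      ψ := ψ m
      r₁ := A (2 * (m + 1)) (σ m 0) (σ m 0) - A (2 * (m + 1)) (σ m 2) (σ m 2)
      r₂ := A (2 * (m + 1)) (σ m 1) (σ m 1) - A (2 * (m + 1)) (σ m 3) (σ m 3)
      y := A (2 * m) (σ m 0) (σ m 3) + A (2 * m) (σ m 2) (σ m 1)
      z := A (2 * m) (σ m 0) (σ m 3) - A (2 * m) (σ m 2) (σ m 1) }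
  have hp₁ : ∀ m, (s m).pivot₁ = 2 * A (2 * m) (σ m 0) (σ m 2) := fun m => (hg m).pivot_ac.symm
  have hp₂ : ∀ m, (s m).pivot₂ = 2 * A (2 * m) (σ m 1) (σ m 3) := fun m => (hg m).pivot_bd.symm
  have hg₁ : ∀ m, (s m).r₁ * Real.cos (2 * (s m).φ) =
    A (2 * m) (σ m 0) (σ m 0) - A (2 * m) (σ m 2) (σ m 2) := fun m => (hg m).gap_ac.symm
  have hg₂ : ∀ m, (s m).r₂ * Real.cos (2 * (s m).ψ) =
    A (2 * m) (σ m 1) (σ m 1) - A (2 * m) (σ m 3) (σ m 3) := fun m => (hg m).gap_bd.symm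
  have hE : ∀ m, (s m).energy = offNorm (A (2 * m)) ^ 2 := by
    intro m
    rw [Stage.energy, hp₁, hp₂, offNorm_sq_eq (h.symm _) (σ m), (hz m).1, (hz m).2,
      (h.symm (2 * m)).apply (σ m 2) (σ m 1)]
    simp only [s]
    ring
  have hrun : Stage.IsRun s := by
    refine ⟨fun m => ⟨(hg m).φ_mem, (hg m).ψ_mem, fun h0 => (hg m).φ_eq_zero ?_,
      fun h0 => (hg m).ψ_eq_zero ?_⟩, fun m => ?_, fun m => ?_, fun m => ?_⟩
    · rw [hp₁] at h0
      linarith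
    · rw [hp₂] at h0
      linarith
    · obtain ⟨l0, l1, l2, l3⟩ := h.label_succ m
      obtain ⟨e1, e2, e3, e4⟩ := he m
      have c1 := cos_add_nonneg (hg m).φ_mem (hg m).ψ_mem
      have c2 := cos_add_nonneg (hg m).φ_mem (neg_mem_jacobiRange (hg m).ψ_mem)
      rw [← sub_eq_add_neg] at c2
      constructor
      · rw [hp₁, hp₂, l0, l1, l2, l3, e1, e2, ← abs_of_nonneg (mul_nonneg zero_le_two c1),
          ← abs_mul, Real.cos_add]
        congr 1
        ring
      · rw [hp₁, hp₂, l0, l1, l2, l3, e1, e2, ← abs_of_nonneg (mul_nonneg zero_le_two c2),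
          ← abs_mul, Real.cos_sub]
        congr 1
        ring
      · change |_ + _| = _
        rw [l0, l1, l2, l3, e3, e4, ← abs_mul, Real.sin_sub, ← abs_neg]
        congr 1
        ring
      · change |_ - _| = _
        rw [l0, l1, l2, l3, e3, e4, ← abs_mul, Real.sin_add]
        congr 1
        ring
    · obtain ⟨l0, l1, l2, l3⟩ := h.label_succ m
      rw [hg₁, hg₂, l0, l1, l2, l3]
      ring
    · obtain ⟨l0, l1, l2, l3⟩ := h.label_succ m
      obtain ⟨k0, k1, k2, k3⟩ := h.label_succ (m + 1)
      have a1 := (hg (m + 1)).add_ac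
      have a2 := (hg (m + 1)).add_bd
      rw [hg₁, hg₂, k0, k1, k2, k3]
      rw [l0, l2] at a1 ⊢
      rw [l1, l3] at a2 ⊢
      linear_combination a1 - a2
  have hle := hrun.energy_six_le
  rw [hE, hE, ← mul_pow] at hle
  exact (abs_le_of_sq_le_sq' hle (mul_nonneg (by norm_num) (offNorm_nonneg _))).2

end IsParallelRun

end ParallelRun

section Convergence

lemma JacobiStep.abs_diag_sub_le_offNorm {A B : Matrix (Fin 4) (Fin 4) ℝ} {i j : Fin 4} {φ : ℝ}
    (hA : A.IsSymm) (hij : i ≠ j) (h : JacobiStep A B i j φ) (l : Fin 4) :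
    |B l l - A l l| ≤ offNorm A := by
  by_cases hi : l = i
  · subst hi
    exact h.abs_diag_sub_le.trans (abs_apply_le_offNorm hA hij)
  by_cases hj : l = j
  · subst hj
    exact (h.abs_diag_sub_le_snd hA).trans (abs_apply_le_offNorm hA hij)
  · rw [h.apply_of_ne l l hi hj hi hj, sub_self, abs_zero]
    exact offNorm_nonneg A

namespace IsParallelRun

variable {σ : ℕ → Equiv.Perm (Fin 4)} {A : ℕ → Matrix (Fin 4) (Fin 4) ℝ}

lemma exists_step (h : IsParallelRun σ A) (k : ℕ) :
    ∃ i j φ, i ≠ j ∧ JacobiStep (A k) (A (k + 1)) i j φ := by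
  obtain ⟨m, rfl | rfl⟩ := k.even_or_odd'
  · obtain ⟨φ, hφ⟩ := h.step_even m
    exact ⟨_, _, φ, by simp, hφ⟩
  · obtain ⟨φ, hφ⟩ := h.step_odd m
    exact ⟨_, _, φ, by simp, hφ⟩

lemma offNorm_antitone (h : IsParallelRun σ A) : Antitone fun k => offNorm (A k) :=
  antitone_nat_of_succ_le fun k => by
    obtain ⟨i, j, φ, hij, hs⟩ := h.exists_step k
    exact hs.offNorm_le (h.symm k) hij

lemma offNorm_add_twelve_le (h : IsParallelRun σ A) (m : ℕ) :
    offNorm (A (2 * (m + 1) + 12)) ≤ (1 - 1 / 10 ^ 5) * offNorm (A (2 * (m + 1))) := by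
  have hz := h.apply_eq_zero m
  have := (h.shift (m + 1)).offNorm_twelve_le (by simpa using hz.1) (by simpa using hz.2)
  simpa [add_comm] using this

lemma summable_offNorm (h : IsParallelRun σ A) : Summable fun k => offNorm (A k) := by
  have hu : StrictMono fun k : ℕ => 12 * k + 2 := fun a b hab => by
    dsimp only
    omega
  refine (summable_schlomilch_iff_of_nonneg (C := 1) (fun k => offNorm_nonneg (A k))
    (fun m n _ hmn => h.offNorm_antitone hmn) (u := fun k => 12 * k + 2) (by simp) hu one_ne_zero
    ?_).1 ?_
  · intro k
    simp only [smul_eq_mul]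
    omega
  · have hle : ∀ k, offNorm (A (12 * k + 2)) ≤ offNorm (A 2) * (1 - 1 / 10 ^ 5) ^ k := by
      intro k
      induction k with
      | zero => simp
      | succ k ih =>
        have h1 := h.offNorm_add_twelve_le (6 * k)
        rw [show 2 * (6 * k + 1) = 12 * k + 2 by ring] at h1
        rw [show 12 * (k + 1) + 2 = 12 * k + 2 + 12 by ring, pow_succ]
        refine h1.trans ?_
        have := mul_le_mul_of_nonneg_left ih
          (show (0 : ℝ) ≤ 1 - 1 / 10 ^ 5 by norm_num)
        linarith
    have hgeo : Summable fun k : ℕ => offNorm (A 2) * (1 - 1 / 10 ^ 5 : ℝ) ^ k :=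
      (summable_geometric_of_lt_one (by norm_num) (by norm_num)).mul_left _
    have := (Summable.of_nonneg_of_le (fun k => offNorm_nonneg _) hle hgeo).mul_left 12
    refine this.congr fun k => ?_
    push_cast
    ring

lemma tendsto_diagonal (h : IsParallelRun σ A) :
    ∃ D : Matrix (Fin 4) (Fin 4) ℝ, D.IsDiag ∧ Tendsto A atTop (𝓝 D) := by
  have hsum := h.summable_offNorm
  have hdiag : ∀ l, ∃ x, Tendsto (fun k => A k l l) atTop (𝓝 x) := fun l =>
    cauchySeq_tendsto_of_complete <| cauchySeq_of_dist_le_of_summable _ (fun k => by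
      obtain ⟨i, j, φ, hij, hs⟩ := h.exists_step k
      rw [dist_comm, Real.dist_eq]
      exact hs.abs_diag_sub_le_offNorm (h.symm k) hij l) hsum
  choose x hx using hdiag
  refine ⟨Matrix.diagonal x, Matrix.isDiag_diagonal x, tendsto_pi_nhds.2 fun i =>
    tendsto_pi_nhds.2 fun j => ?_⟩
  by_cases hij : i = j
  · subst hij
    rw [Matrix.diagonal_apply_eq]
    exact hx i
  · rw [Matrix.diagonal_apply_ne x hij]
    exact squeeze_zero_norm (fun k => abs_apply_le_offNorm (h.symm k) hij)
      hsum.tendsto_atTop_zero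

end IsParallelRun

/-- The pivot pair `p` consists of the indices `i` and `j`. -/
abbrev PivotPair.IsPair {n : ℕ} (p : PivotPair n) (i j : Fin n) : Prop :=
  (p.1.1 = i ∧ p.1.2 = j) ∨ (p.1.1 = j ∧ p.1.2 = i)

lemma JacobiStep.of_isPair {n : ℕ} {A B : Matrix (Fin n) (Fin n) ℝ} {p : PivotPair n}
    {i j : Fin n} {φ : ℝ} (hA : A.IsSymm) (h : JacobiStep A B p.1.1 p.1.2 φ)
    (hp : p.IsPair i j) : ∃ φ, JacobiStep A B i j φ := by
  rcases hp with ⟨rfl, rfl⟩ | ⟨rfl, rfl⟩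
  · exact ⟨φ, h⟩
  · exact ⟨-φ, h.swap hA⟩

/-- The ordering `O` runs through the parallel pairings in the order given by the labelling `σ`. -/
abbrev FollowsLabels (O : Fin 6 → PivotPair 4) (σ : Equiv.Perm (Fin 4)) : Prop :=
  ∀ r : Fin 3, (O (Fin.ofNat 6 (2 * r))).IsPair ((σ * nextLabels ^ (r : ℕ)) 0)
      ((σ * nextLabels ^ (r : ℕ)) 2) ∧
    (O (Fin.ofNat 6 (2 * r + 1))).IsPair ((σ * nextLabels ^ (r : ℕ)) 1)
      ((σ * nextLabels ^ (r : ℕ)) 3)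

lemma isParallelRun_of_isJacobiSequence {O : Fin 6 → PivotPair 4} {σ : Equiv.Perm (Fin 4)}
    (hO : FollowsLabels O σ) {A : ℕ → Matrix (Fin 4) (Fin 4) ℝ} (h0 : (A 0).IsSymm)
    (hA : IsJacobiSequence (cyclicStrategy O) A) :
    IsParallelRun (fun m => σ * nextLabels ^ m) A := by
  have hsymm : ∀ k, (A k).IsSymm := by
    intro k
    induction k with
    | zero => exact h0
    | succ k ih =>
      obtain ⟨φ, hφ, hk⟩ := hA k
      exact (jacobiStep_of_isJacobiAngle ih hφ hk).symm
  have hpow : nextLabels ^ 3 = 1 := by decide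
  have hlab : ∀ m, nextLabels ^ m = nextLabels ^ (m % 3) := fun m =>
    pow_eq_pow_mod m hpow
  have hstep : ∀ k, ∃ φ, JacobiStep (A k) (A (k + 1)) (cyclicStrategy O k).1.1
      (cyclicStrategy O k).1.2 φ := fun k =>
    let ⟨φ, hφ, hk⟩ := hA k
    ⟨φ, jacobiStep_of_isJacobiAngle (hsymm k) hφ hk⟩
  refine ⟨fun m => by rw [pow_succ, mul_assoc], hsymm, fun m => ?_, fun m => ?_⟩
  · obtain ⟨φ, hφ⟩ := hstep (2 * m)
    refine hφ.of_isPair (hsymm _) ?_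
    have := (hO ⟨m % 3, Nat.mod_lt _ (by norm_num)⟩).1
    rw [hlab]
    convert this using 1
    refine congrArg O (Fin.ext ?_)
    change 2 * m % 6 = 2 * (m % 3) % 6
    omega
  · obtain ⟨φ, hφ⟩ := hstep (2 * m + 1)
    refine hφ.of_isPair (hsymm _) ?_
    have := (hO ⟨m % 3, Nat.mod_lt _ (by norm_num)⟩).2
    rw [hlab]
    convert this using 1
    refine congrArg O (Fin.ext ?_)
    change (2 * m + 1) % 6 = (2 * (m % 3) + 1) % 6
    omega

lemma ordering1_followsLabels : FollowsLabels ordering1 1 := by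
  decide

lemma exists_followsLabels {O : Fin 6 → PivotPair 4} (hO : O ∈ parallelOrderings) :
    ∃ σ, FollowsLabels O σ := by
  simp only [parallelOrderings, List.mem_cons, List.not_mem_nil, or_false] at hO
  rcases hO with rfl | rfl | rfl | rfl | rfl | rfl
  · exact ⟨1, ordering1_followsLabels⟩
  · exact ⟨nextLabels ^ 2, by decide⟩
  · exact ⟨nextLabels, by decide⟩
  · exact ⟨Equiv.swap 2 3, by decide⟩
  · exact ⟨Equiv.swap 1 2, by decide⟩
  · exact ⟨Equiv.swap 1 3, by decide⟩

end Convergence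

theorem mainTheorem1 :
    (∀ A : ℕ → Matrix (Fin 4) (Fin 4) ℝ, (A 0).IsSymm → A 0 0 1 = 0 → A 0 2 3 = 0 →
      IsJacobiSequence (cyclicStrategy ordering1) A →
      offNorm (A 12) ≤ (1 - 1 / 10 ^ 5) * offNorm (A 0)) ∧
    (∀ O ∈ parallelOrderings, GloballyConvergent (cyclicStrategy O)) := by
  refine ⟨fun A h0 h01 h23 hA => ?_, fun O hO A h0 hA => ?_⟩
  · exact (isParallelRun_of_isJacobiSequence ordering1_followsLabels h0 hA).offNorm_twelve_le
      (by simpa using h01) (by simpa using h23)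
  · obtain ⟨σ, hσ⟩ := exists_followsLabels hO
    exact (isParallelRun_of_isJacobiSequence hσ h0 hA).tendsto_diagonal
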